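/- Let $G=(V,E)$ be a finite bipartite graph with at least one vertex, regarded as a simplicial complex whose faces are its vertices and its edges. Then $G$ is $d$-Tverberg for some integer $d\ge 1$. That is, there are integers $d\ge 1$ and $N$ such that every finite set $S\subset\mathbb{R}^d$ of at least $N$ points in general position (any at most $d+1$ points of $S$ are affinely independent) has a partition $S=S_1\sqcup\dots\sqcup S_m$ into nonempty parts whose nerve is isomorphic to $G$ as a simplicial complex. Here the nerve of the partition is the simplicial complex on the vertex set $\{1,\dots,m\}$ whose faces are the nonempty sets $I\subset\{1,\dots,m\}$ with $\bigcap_{i\in I}\operatorname{conv}(S_i)\neq\emptyset$. -/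

import Mathlib

namespace TverbergNerve

/-- Two abstract simplicial complexes are isomorphic if some bijection between their vertex sets
carries faces to faces in both directions. -/
def IsIsomorphic {α β : Type*} (K : AbstractSimplicialComplex α)
    (L : AbstractSimplicialComplex β) : Prop :=
  ∃ e : α ≃ β, ∀ s : Finset α, s.map e.toEmbedding ∈ L.faces ↔ s ∈ K.faces

/-- The nerve of a family of nonempty sets: its vertices are the indices, and a nonempty finite
set of indices is a face exactly when the corresponding sets have a common point. -/
def nerve {ι E : Type*} (F : ι → Set E) (hF : ∀ i, (F i).Nonempty) :
    AbstractSimplicialComplex ι where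
  faces := {I | I.Nonempty ∧ (⋂ i ∈ I, F i).Nonempty}
  isRelLowerSet_faces := fun {_} hI =>
    ⟨hI.1, fun _ hJI hJ => ⟨hJ, hI.2.mono (Set.biInter_subset_biInter_left hJI)⟩⟩
  singleton_mem := fun i => ⟨Finset.singleton_nonempty i, by simpa using hF i⟩

/-- A partition of a set `S` into `m` nonempty color classes. -/
structure ColorPartition {E : Type*} (S : Set E) (m : ℕ) where
  part : Fin m → Set E
  nonempty_part : ∀ i, (part i).Nonempty
  disjoint_part : Pairwise fun i j => Disjoint (part i) (part j)
  iUnion_part : ⋃ i, part i = S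

/-- The nerve of a partition of a point set: the nerve of the convex hulls of its parts. -/
def ColorPartition.nerve {d m : ℕ} {S : Set (EuclideanSpace ℝ (Fin d))}
    (P : ColorPartition S m) : AbstractSimplicialComplex (Fin m) :=
  TverbergNerve.nerve (fun i => convexHull ℝ (P.part i))
    (fun i => (P.nonempty_part i).convexHull)

/-- A complex is partition-induced on a point set `S` in `ℝᵈ` if it is isomorphic to the nerve of
some partition of `S`. -/
def IsPartitionInduced {V : Type*} (K : AbstractSimplicialComplex V) {d : ℕ}
    (S : Set (EuclideanSpace ℝ (Fin d))) : Prop :=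
  ∃ (m : ℕ) (P : ColorPartition S m), IsIsomorphic P.nerve K

/-- A set of points in `ℝᵈ` is in general position if any at most `d + 1` of its points are
affinely independent. -/
def InGeneralPosition {d : ℕ} (S : Set (EuclideanSpace ℝ (Fin d))) : Prop :=
  ∀ T : Finset (EuclideanSpace ℝ (Fin d)), (T : Set (EuclideanSpace ℝ (Fin d))) ⊆ S →
    T.card ≤ d + 1 →
    AffineIndependent ℝ (fun x : T => (x : EuclideanSpace ℝ (Fin d)))

/-- A complex is `d`-Tverberg if it is partition-induced on every sufficiently large finite set of
points in general position in `ℝᵈ`. -/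
def IsTverberg (d : ℕ) {V : Type*} (K : AbstractSimplicialComplex V) : Prop :=
  ∃ N : ℕ, ∀ S : Finset (EuclideanSpace ℝ (Fin d)),
    InGeneralPosition (S : Set (EuclideanSpace ℝ (Fin d))) → N ≤ S.card →
      IsPartitionInduced K (S : Set (EuclideanSpace ℝ (Fin d)))

/-- A graph as a simplicial complex of dimension at most one: the faces are the single vertices
and the edges. -/
def graphComplex {V : Type*} (G : SimpleGraph V) : AbstractSimplicialComplex V where
  faces := {s | (∃ v, (s : Set V) = {v}) ∨ ∃ u v, G.Adj u v ∧ (s : Set V) = {u, v}}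
  isRelLowerSet_faces := by
    rintro s hs
    refine ⟨?_, fun t hts ht => ?_⟩
    · rcases hs with ⟨v, hv⟩ | ⟨u, v, -, hv⟩
      · exact ⟨v, by rw [← Finset.mem_coe, hv]; simp⟩
      · exact ⟨u, by rw [← Finset.mem_coe, hv]; simp⟩
    · have hts' : (t : Set V) ⊆ (s : Set V) := Finset.coe_subset.mpr hts
      have ht' : (t : Set V) ≠ ∅ := (Finset.coe_nonempty.mpr ht).ne_empty
      rcases hs with ⟨v, hv⟩ | ⟨u, v, h, hv⟩
      · rw [hv] at hts'
        exact Or.inl ⟨v, (Set.subset_singleton_iff_eq.mp hts').resolve_left ht'⟩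
      · rw [hv] at hts'
        rcases Set.subset_pair_iff_eq.mp hts' with h0 | h1 | h2 | h3
        · exact absurd h0 ht'
        · exact Or.inl ⟨u, h1⟩
        · exact Or.inl ⟨v, h2⟩
        · exact Or.inr ⟨u, v, h, h3⟩
  singleton_mem := fun v => Or.inl ⟨v, by simp⟩

end TverbergNerve

/-!
Every finite triangle-free graph `G` with a vertex, in particular every bipartite one, is
`d`-Tverberg for `d = |E| + |V|`, the number of faces of the complex of `G`.

Suppose that an affine function `φ v` on `ℝᵈ` is attached to each vertex `v`, and that every point
`x` of `S` is given to a vertex `v` with `φ v x > φ w x` for all `w ≠ v` not adjacent to `v`. Then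
the classes of nonadjacent vertices `v`, `w` are separated by the hyperplane `φ v = φ w`, and since
`G` has no triangles, the nerve has no faces besides vertices and edges of `G`. A vertex maximizing
`φ v x` is always an admissible choice, so no point of `S` is left over. To make the classes of two
adjacent vertices `u`, `v` meet, it suffices to have `d + 2` points of `S` at which `φ u` and `φ v`
are positive and all other functions are negative: these points may go to `u` or to `v` at will, and
Radon's theorem splits them into two parts with intersecting hulls. Likewise a point at which only
`φ v` is positive makes the class of `v` nonempty. This is `isPartitionInduced_of_blocks`.

It remains to find one block of `d + 2` points for each of the `d` faces such that the signs of an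
affine function can be prescribed block by block (`exists_blocks_prescribed_sign`). By Ramsey's
theorem for `(d + 1)`-uniform hypergraphs (`exists_ramsey`), a large `S` contains a long sequence
all of whose increasing `(d + 1)`-tuples have the same orientation (`exists_homogeneous`). As on the
moment curve, the affine function vanishing at `d` members of the sequence changes sign along the
sequence exactly at these members. Cut the sequence into `d` consecutive blocks with a spare point
on either side of each. A hyperplane through one spare point of every block, chosen before or after
the block according to the desired sign, has the prescribed signs.
-/

namespace TverbergNerve

/-! ### Ramsey's theorem for hypergraphs -/

/-- Finite Ramsey theorem for `k`-uniform hypergraphs and two colours, in the asymmetric form. -/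
theorem exists_ramsey (k : ℕ) : ∀ p q : ℕ, ∃ N : ℕ, ∀ {α : Type*} (S : Finset α)
    (c : Finset α → Prop), N ≤ S.card → ∃ T ⊆ S,
      (p ≤ T.card ∧ ∀ U ⊆ T, U.card = k → c U) ∨
      (q ≤ T.card ∧ ∀ U ⊆ T, U.card = k → ¬ c U) := by
  classical
  induction k with
  | zero =>
    intro p q
    refine ⟨p + q, fun S c hS => ⟨S, subset_rfl, ?_⟩⟩
    by_cases h : c ∅
    · refine Or.inl ⟨by omega, fun U _ hU => ?_⟩
      rwa [Finset.card_eq_zero.mp hU]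
    · refine Or.inr ⟨by omega, fun U _ hU => ?_⟩
      rwa [Finset.card_eq_zero.mp hU]
  | succ k ih =>
    intro p
    induction p with
    | zero =>
      refine fun q => ⟨0, fun S c _ => ⟨∅, by simp, Or.inl ⟨by simp, fun U hU h => ?_⟩⟩⟩
      simp [Finset.subset_empty.mp hU] at h
    | succ p ihp =>
      intro q
      induction q with
      | zero =>
        refine ⟨0, fun S c _ => ⟨∅, by simp, Or.inr ⟨by simp, fun U hU h => ?_⟩⟩⟩
        simp [Finset.subset_empty.mp hU] at h
      | succ q ihq =>
        obtain ⟨N₁, h₁⟩ := ihp (q + 1)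
        obtain ⟨N₂, h₂⟩ := ihq
        obtain ⟨M, hM⟩ := ih N₁ N₂
        refine ⟨M + 1, fun S c hS => ?_⟩
        obtain ⟨x, hx⟩ : S.Nonempty := Finset.card_pos.mp (by omega)
        -- Homogeneity of the link of `x` on `T` lets `x` be added to one kind of subset of `T`.
        obtain ⟨T, hTS, hT⟩ := hM (S.erase x) (fun U => c (insert x U))
          (by rw [Finset.card_erase_of_mem hx]; omega)
        have hTS' : T ⊆ S := hTS.trans (Finset.erase_subset _ _)
        have hxT : x ∉ T := fun h => by simpa using hTS h
        have extend : ∀ (P : Finset _ → Prop), (∀ U ⊆ T, U.card = k → P (insert x U)) →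
            ∀ T' ⊆ T, (∀ U ⊆ T', U.card = k + 1 → P U) →
            ∀ U ⊆ insert x T', U.card = k + 1 → P U := by
          intro P hP T' hT' hP' U hU hc
          by_cases hxU : x ∈ U
          · rw [← Finset.insert_erase hxU]
            refine hP _ ((Finset.subset_insert_iff.mp hU).trans hT') ?_
            rw [Finset.card_erase_of_mem hxU, hc, Nat.add_sub_cancel]
          · exact hP' U ((Finset.subset_insert_iff_of_notMem hxU).mp hU) hc
        rcases hT with ⟨hc, hT⟩ | ⟨hc, hT⟩
        · obtain ⟨T', hT', ⟨hp, h⟩ | ⟨hq, h⟩⟩ := h₁ T c hc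
          · refine ⟨insert x T', Finset.insert_subset hx (hT'.trans hTS'), Or.inl ⟨?_, ?_⟩⟩
            · rw [Finset.card_insert_of_notMem fun h => hxT (hT' h)]; omega
            · exact extend c hT T' hT' h
          · exact ⟨T', hT'.trans hTS', Or.inr ⟨hq, h⟩⟩
        · obtain ⟨T', hT', ⟨hp, h⟩ | ⟨hq, h⟩⟩ := h₂ T c hc
          · exact ⟨T', hT'.trans hTS', Or.inl ⟨hp, h⟩⟩
          · refine ⟨insert x T', Finset.insert_subset hx (hT'.trans hTS'), Or.inr ⟨?_, ?_⟩⟩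
            · rw [Finset.card_insert_of_notMem fun h => hxT (hT' h)]; omega
            · exact extend (fun U => ¬ c U) hT T' hT' h

/-! ### Orientations and homogeneous sequences -/

/-- Homogeneous coordinates: the point `x` is sent to the vector `(1, x)`. -/
noncomputable def homogenize (d : ℕ) : EuclideanSpace ℝ (Fin d) →ᵃ[ℝ] (Fin (d + 1) → ℝ) where
  toFun x := Fin.cons 1 x.ofLp
  linear :=
    { toFun := fun x => Fin.cons 0 x.ofLp
      map_add' := fun x y => by ext i; cases i using Fin.cases <;> simp
      map_smul' := fun a x => by ext i; cases i using Fin.cases <;> simp }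
  map_vadd' p v := by ext i; cases i using Fin.cases <;> simp

/-- The orientation determinant of `d + 1` points of `ℝᵈ`. -/
noncomputable def orientationDet {d : ℕ} (p : Fin (d + 1) → EuclideanSpace ℝ (Fin d)) : ℝ :=
  Matrix.detRowAlternating (homogenize d ∘ p)

theorem orientationDet_ne_zero {d : ℕ} {p : Fin (d + 1) → EuclideanSpace ℝ (Fin d)}
    (hp : AffineIndependent ℝ p) : orientationDet p ≠ 0 := by
  have hli : LinearIndependent ℝ (homogenize d ∘ p) := by
    rw [Fintype.linearIndependent_iff]
    intro g hg i
    refine affineIndependent_iff.mp hp Finset.univ g ?_ ?_ i (Finset.mem_univ i)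
    · simpa [homogenize] using congrFun hg 0
    · ext j
      simpa [homogenize] using congrFun hg j.succ
  have := Matrix.linearIndependent_rows_iff_isUnit (A := Matrix.of (homogenize d ∘ p)) |>.mp hli
  exact ((Matrix.isUnit_iff_isUnit_det _).mp this).ne_zero

/-- Moving the first point to position `k` is a cycle of sign `(-1) ^ k`. -/
theorem orientationDet_cons {d : ℕ} (k : Fin (d + 1)) (x : EuclideanSpace ℝ (Fin d))
    (p : Fin d → EuclideanSpace ℝ (Fin d)) :
    orientationDet (Fin.cons x p : Fin (d + 1) → _) =
      (-1) ^ (k : ℕ) * orientationDet (k.insertNth x p : Fin (d + 1) → _) := by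
  rw [← Fin.insertNth_comp_cycleRange_symm k x p, orientationDet, ← Function.comp_assoc,
    AlternatingMap.map_perm, Equiv.Perm.sign_symm, Fin.sign_cycleRange]
  simp [orientationDet, Units.smul_def]

/-- With the other `d` points fixed, the orientation determinant is an affine function of the first
one. -/
theorem exists_affineMap_eq_orientationDet {d : ℕ} (p : Fin d → EuclideanSpace ℝ (Fin d)) :
    ∃ φ : EuclideanSpace ℝ (Fin d) →ᵃ[ℝ] ℝ, ∀ x,
      φ x = orientationDet (Fin.cons x p : Fin (d + 1) → _) := by
  refine ⟨((Matrix.detRowAlternating (R := ℝ) (n := Fin (d + 1))).toMultilinearMap.toLinearMap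
    (Fin.cons 0 (homogenize d ∘ p)) 0).toAffineMap.comp (homogenize d), fun x => ?_⟩
  change Matrix.detRowAlternating (Function.update
    (Fin.cons 0 (homogenize d ∘ p) : Fin (d + 1) → Fin (d + 1) → ℝ) 0 (homogenize d x)) =
    Matrix.detRowAlternating _
  rw [Fin.update_cons_zero]
  congr 1
  ext i : 1
  cases i using Fin.cases <;> rfl

/-- A large set in general position contains an injective sequence, indexed by any given finite
linear order, all of whose increasing `(d + 1)`-tuples have the same orientation. -/
theorem exists_homogeneous (d : ℕ) (I : Type) [LinearOrder I] [Fintype I] :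
    ∃ N : ℕ, ∀ S : Finset (EuclideanSpace ℝ (Fin d)),
      InGeneralPosition (S : Set (EuclideanSpace ℝ (Fin d))) → N ≤ S.card →
      ∃ (q : I → EuclideanSpace ℝ (Fin d)) (σ : ℝ), Function.Injective q ∧ (∀ i, q i ∈ S) ∧
        ∀ f : Fin (d + 1) → I, StrictMono f → 0 < σ * orientationDet (q ∘ f) := by
  classical
  obtain ⟨N, hN⟩ := exists_ramsey (d + 1) (Fintype.card I) (Fintype.card I)
  refine ⟨N, fun S hS hcard => ?_⟩
  let p : Fin S.card → EuclideanSpace ℝ (Fin d) := fun i => (S.equivFin.symm i).1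
  have hp : Function.Injective p := Subtype.val_injective.comp S.equivFin.symm.injective
  have hne : ∀ f : Fin (d + 1) → Fin S.card, StrictMono f → orientationDet (p ∘ f) ≠ 0 := by
    intro f hf
    have hpf : Function.Injective (p ∘ f) := hp.comp hf.injective
    set T := Finset.univ.image (p ∘ f)
    have hai := hS T
      (fun x hx => by
        obtain ⟨i, -, rfl⟩ := Finset.mem_image.mp hx
        exact (S.equivFin.symm (f i)).2)
      (Finset.card_image_le.trans (by simp))
    have hmem : ∀ i, (p ∘ f) i ∈ T := fun i => Finset.mem_image_of_mem _ (Finset.mem_univ i)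
    let g : Fin (d + 1) ↪ T := ⟨fun i => ⟨(p ∘ f) i, hmem i⟩,
      fun i j h => hpf (Subtype.mk.inj h)⟩
    exact orientationDet_ne_zero (p := p ∘ f) (hai.comp_embedding g)
  -- Every strictly increasing tuple is the increasing enumeration of its range.
  have key : ∀ (T : Finset (Fin S.card)) (P : ℝ → Prop), Fintype.card I ≤ T.card →
      (∀ U ⊆ T, ∀ h : U.card = d + 1, P (orientationDet (p ∘ U.orderEmbOfFin h))) →
      ∃ q : I → EuclideanSpace ℝ (Fin d), Function.Injective q ∧ (∀ i, q i ∈ S) ∧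
        ∀ f : Fin (d + 1) → I, StrictMono f → orientationDet (q ∘ f) ≠ 0 ∧
          P (orientationDet (q ∘ f)) := by
    intro T P hT hP
    let g : I ↪o Fin S.card := (Fintype.orderIsoFinOfCardEq I rfl).symm.toOrderEmbedding.trans
      ((Fin.castLEOrderEmb hT).trans (T.orderEmbOfFin rfl))
    have hg : ∀ i, g i ∈ T := fun i => T.orderEmbOfFin_mem rfl _
    refine ⟨p ∘ g, hp.comp g.injective, fun i => (S.equivFin.symm (g i)).2, fun f hf => ?_⟩
    have hgf : StrictMono (g ∘ f) := g.strictMono.comp hf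
    refine ⟨hne _ hgf, ?_⟩
    have hU : (Finset.univ.image (g ∘ f)).card = d + 1 := by
      rw [Finset.card_image_of_injective _ hgf.injective]; simp
    have := hP (Finset.univ.image (g ∘ f)) (fun x hx => by
      obtain ⟨i, -, rfl⟩ := Finset.mem_image.mp hx
      exact hg _) hU
    rwa [← Finset.orderEmbOfFin_unique hU (fun i => by simp) hgf] at this
  obtain ⟨T, -, ⟨hT, h⟩ | ⟨hT, h⟩⟩ := hN Finset.univ
    (fun U : Finset (Fin S.card) => ∀ h : U.card = d + 1,
      0 < orientationDet (p ∘ U.orderEmbOfFin h)) (by simpa using hcard)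
  · obtain ⟨q, hq, hqS, hqf⟩ := key T (fun r => 0 < r) hT fun U hU hc => h U hU hc hc
    exact ⟨q, 1, hq, hqS, fun f hf => by simpa using (hqf f hf).2⟩
  · obtain ⟨q, hq, hqS, hqf⟩ := key T (fun r => ¬ 0 < r) hT
      fun U hU hc h0 => h U hU hc fun _ => h0
    refine ⟨q, -1, hq, hqS, fun f hf => ?_⟩
    have := lt_of_le_of_ne (not_lt.mp (hqf f hf).2) (hqf f hf).1
    linarith

/-! ### Blocks with prescribed signs -/

/-- A large set in general position contains `d` disjoint blocks of `d + 2` points such that the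
signs of an affine function can be prescribed on each block independently. -/
theorem exists_blocks_prescribed_sign (d : ℕ) :
    ∃ N : ℕ, ∀ S : Finset (EuclideanSpace ℝ (Fin d)),
      InGeneralPosition (S : Set (EuclideanSpace ℝ (Fin d))) → N ≤ S.card →
      ∃ B : Fin d × Fin (d + 2) → EuclideanSpace ℝ (Fin d),
        Function.Injective B ∧ (∀ i, B i ∈ S) ∧
        ∀ W : Fin d → Prop, ∃ φ : EuclideanSpace ℝ (Fin d) →ᵃ[ℝ] ℝ,
          ∀ j t, (W j → 0 < φ (B (j, t))) ∧ (¬ W j → φ (B (j, t)) < 0) := by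
  classical
  -- Each block comes with one spare point before it and one after it.
  obtain ⟨N, hN⟩ := exists_homogeneous d (Fin d ×ₗ Fin (d + 4))
  refine ⟨N, fun S hS hcard => ?_⟩
  obtain ⟨q, σ, hq, hqS, hσ⟩ := hN S hS hcard
  refine ⟨fun i => q (toLex (i.1, i.2.succ.castSucc)), fun i i' h => ?_, fun i => hqS _,
    fun W => ?_⟩
  · have := toLex.injective (hq h)
    simp only [Prod.mk.injEq, Fin.castSucc_inj, Fin.succ_inj] at this
    exact Prod.ext this.1 this.2
  -- The hyperplane passes through exactly one spare point of each block, so that `j` sign changes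
  -- come from the earlier blocks, and one more if the spare point chosen for block `j` precedes it.
  let z : Fin d → Fin d ×ₗ Fin (d + 4) := fun j =>
    toLex (j, if W j ↔ Even (j : ℕ) then Fin.last _ else 0)
  have hz : StrictMono z := fun i j hij => Prod.Lex.lt_iff.mpr (Or.inl hij)
  obtain ⟨φ, hφ⟩ := exists_affineMap_eq_orientationDet (q ∘ z)
  have sign : ∀ (x : Fin d ×ₗ Fin (d + 4)) (k : Fin (d + 1)),
      (∀ i : Fin d, i.castSucc < k → z i < x) → (∀ i : Fin d, k ≤ i.castSucc → x < z i) →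
      ∃ r : ℝ, 0 < r ∧ (σ • φ) (q x) = (-1) ^ (k : ℕ) * r := by
    intro x k h₁ h₂
    refine ⟨_, hσ _ ((Fin.strictMono_insertNth_iff k x z).mpr ⟨hz, h₁, h₂⟩), ?_⟩
    have : (k.insertNth (q x) (q ∘ z) : Fin (d + 1) → _) =
        q ∘ (k.insertNth x z : Fin (d + 1) → _) := by
      ext1 i
      cases i using Fin.succAboveCases k <;> simp
    rw [AffineMap.coe_smul, Pi.smul_apply, hφ, orientationDet_cons k, this, smul_eq_mul]
    ring
  refine ⟨σ • φ, fun j t => ?_⟩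
  have ht₁ : t.succ.castSucc < Fin.last (d + 3) := Fin.castSucc_lt_last _
  by_cases hW : W j ↔ Even (j : ℕ)
  · obtain ⟨r, hr, h⟩ := sign (toLex (j, t.succ.castSucc)) j.castSucc
      (fun i hi => Prod.Lex.lt_iff.mpr (Or.inl hi))
      (fun i hi => Prod.Lex.lt_iff.mpr (by
        rcases (Fin.castSucc_le_castSucc_iff.mp hi).eq_or_lt with rfl | hi
        · exact Or.inr ⟨rfl, by simpa [z, hW] using ht₁⟩
        · exact Or.inl hi))
    rw [h, Fin.val_castSucc]
    refine ⟨fun hj => ?_, fun hj => ?_⟩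
    · simpa [(hW.mp hj).neg_one_pow] using hr
    · have : Odd (j : ℕ) := Nat.not_even_iff_odd.mp fun h => hj (hW.mpr h)
      simpa [this.neg_one_pow] using hr
  · obtain ⟨r, hr, h⟩ := sign (toLex (j, t.succ.castSucc)) j.succ
      (fun i hi => Prod.Lex.lt_iff.mpr (by
        rcases (Fin.castSucc_lt_succ_iff.mp hi).eq_or_lt with rfl | hi
        · exact Or.inr ⟨rfl, by simp [z, hW]⟩
        · exact Or.inl hi))
      (fun i hi => Prod.Lex.lt_iff.mpr (Or.inl (Fin.succ_le_castSucc_iff.mp hi)))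
    rw [h, Fin.val_succ]
    refine ⟨fun hj => ?_, fun hj => ?_⟩
    · have : Odd (j : ℕ) := Nat.not_even_iff_odd.mp fun h => hW ⟨fun _ => h, fun _ => hj⟩
      simpa [this.add_one.neg_one_pow] using hr
    · have : Even (j : ℕ) := by
        by_contra h
        exact hW ⟨fun h' => absurd h' hj, fun h' => absurd h' h⟩
      simpa [this.add_one.neg_one_pow] using hr

/-! ### The partition -/

/-- Radon's theorem for a family of `d + 2` points of `ℝᵈ`, as a two-coloring of the indices. -/
theorem exists_radon_coloring {d : ℕ} {V : Type*} (p : Fin (d + 2) → EuclideanSpace ℝ (Fin d))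
    (u v : V) : ∃ a : Fin (d + 2) → V, (∀ t, a t = u ∨ a t = v) ∧
      ∃ x, ∀ w, w = u ∨ w = v → x ∈ convexHull ℝ (p '' {t | a t = w}) := by
  classical
  have hp : ¬ AffineIndependent ℝ p := fun h => by
    have := h.card_le_finrank_succ.trans
      (Nat.add_le_add_right (Submodule.finrank_le (vectorSpan ℝ (Set.range p))) 1)
    simp at this
  obtain ⟨I, x, hx₁, hx₂⟩ := Convex.radon_partition hp
  refine ⟨fun t => if t ∈ I then u else v, fun t => by by_cases h : t ∈ I <;> simp [h], x, ?_⟩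
  rintro w (rfl | rfl)
  · exact convexHull_mono (Set.image_mono fun t ht => if_pos ht) hx₁
  · exact convexHull_mono (Set.image_mono fun t ht => if_neg ht) hx₂

/-- The vertices of the face of `graphComplex G` given by an edge or a vertex of `G`. -/
def faceVertices {V : Type*} (G : SimpleGraph V) : G.edgeSet ⊕ V → Set V
  | .inl e => {v | v ∈ e.1}
  | .inr v => {v}

theorem adj_of_mem_faceVertices {V : Type*} {G : SimpleGraph V} {j : G.edgeSet ⊕ V} {u v : V}
    (hu : u ∈ faceVertices G j) (hv : v ∈ faceVertices G j) (huv : u ≠ v) : G.Adj u v := by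
  rcases j with e | w
  · rw [← SimpleGraph.mem_edgeSet, ← (Sym2.mem_and_mem_iff huv).mp ⟨hu, hv⟩]
    exact e.2
  · exact absurd (Eq.trans hu (Eq.symm hv)) huv

/-- Radon colorings of the blocks: a block attached to a face is colored by the vertices of the
face, so that the color classes of these vertices have hulls with a common point. -/
theorem exists_block_coloring {V : Type*} (G : SimpleGraph V) {d : ℕ}
    (p : Fin (d + 2) → EuclideanSpace ℝ (Fin d)) (j : G.edgeSet ⊕ V) :
    ∃ a : Fin (d + 2) → V, (∀ t, a t ∈ faceVertices G j) ∧
      ∃ x, ∀ w ∈ faceVertices G j, x ∈ convexHull ℝ (p '' {t | a t = w}) := by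
  rcases j with ⟨e, he⟩ | v
  · induction e with
    | _ u v =>
      obtain ⟨a, ha, x, hx⟩ := exists_radon_coloring p u v
      exact ⟨a, fun t => Sym2.mem_iff.mpr (ha t), x, fun w hw => hx w (Sym2.mem_iff.mp hw)⟩
  · obtain ⟨a, ha, x, hx⟩ := exists_radon_coloring p v v
    exact ⟨a, fun t => or_self_iff.mp (ha t), x, fun w hw => hx w (Or.inl hw)⟩

/-- If affine functions attached to the vertices are positive on a block exactly when the vertex
belongs to the face of that block, then `G` is partition-induced. Every point is given to a vertex
whose function is the largest there, except that the points of a block attached to an edge are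
distributed among its two endpoints. -/
theorem isPartitionInduced_of_blocks {V : Type*} [Finite V] [Nonempty V] (G : SimpleGraph V)
    (hG : G.CliqueFree 3) {d : ℕ} (S : Finset (EuclideanSpace ℝ (Fin d)))
    (B : (G.edgeSet ⊕ V) × Fin (d + 2) → EuclideanSpace ℝ (Fin d)) (hB : Function.Injective B)
    (hBS : ∀ i, B i ∈ S) (φ : V → EuclideanSpace ℝ (Fin d) →ᵃ[ℝ] ℝ)
    (hpos : ∀ v j t, v ∈ faceVertices G j → 0 < φ v (B (j, t)))
    (hneg : ∀ v j t, v ∉ faceVertices G j → φ v (B (j, t)) < 0) :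
    IsPartitionInduced (graphComplex G) (S : Set (EuclideanSpace ℝ (Fin d))) := by
  classical
  obtain ⟨m, ⟨ε⟩⟩ := Finite.exists_equiv_fin V
  -- Ties between affine functions are broken by the numbering of the vertices.
  let key : EuclideanSpace ℝ (Fin d) → V → ℝ ×ₗ Fin m := fun x v => toLex (φ v x, ε v)
  have hkey : ∀ x, Function.Injective (key x) := fun x u v h =>
    ε.injective (congrArg Prod.snd (toLex.injective h))
  have hconv : ∀ u v, Convex ℝ {x | key x u < key x v} := by
    intro u v
    have hlt : Convex ℝ {x | φ u x < φ v x} := by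
      have := (convex_Ioi (0 : ℝ)).affine_preimage (φ v - φ u)
      simpa [Set.preimage] using this
    have hle : Convex ℝ {x | φ u x ≤ φ v x} := by
      have := (convex_Ici (0 : ℝ)).affine_preimage (φ v - φ u)
      simpa [Set.preimage] using this
    by_cases h : ε u < ε v
    · convert hle using 2
      simp [key, Prod.Lex.lt_iff, h, le_iff_lt_or_eq]
    · convert hlt using 2
      simp [key, Prod.Lex.lt_iff, h]
  choose a ha y hy using fun j => exists_block_coloring G (fun t => B (j, t)) j
  have hcolor : ∀ x, ∃ v, (∀ w ≠ v, ¬ G.Adj w v → key x w < key x v) ∧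
      ∀ j t, x = B (j, t) → a j t = v := by
    intro x
    by_cases hx : ∃ j t, x = B (j, t)
    · obtain ⟨j, t, rfl⟩ := hx
      refine ⟨a j t, fun w hw hadj => ?_, fun j' t' h => ?_⟩
      · refine Prod.Lex.lt_iff.mpr (Or.inl ((hneg w j t fun hwj => ?_).trans (hpos _ j t (ha j t))))
        exact hadj (adj_of_mem_faceVertices hwj (ha j t) hw)
      · obtain ⟨rfl, rfl⟩ := Prod.mk.inj (hB h)
        rfl
    · obtain ⟨v, hv⟩ : ∃ v, ∀ w, key x w ≤ key x v := Finite.exists_max _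
      exact ⟨v, fun w hw _ => (hv w).lt_of_ne fun h => hw (hkey x h),
        fun j t h => absurd ⟨j, t, h⟩ hx⟩
  choose c hc hcB using hcolor
  let part : V → Set (EuclideanSpace ℝ (Fin d)) := fun v => {x | x ∈ S ∧ c x = v}
  have hface : ∀ j, ∀ w ∈ faceVertices G j, y j ∈ convexHull ℝ (part w) := by
    refine fun j w hw => convexHull_mono ?_ (hy j w hw)
    rintro _ ⟨t, ht, rfl⟩
    exact ⟨hBS _, (hcB _ j t rfl).symm.trans ht⟩
  have hadj : ∀ u v x, u ≠ v → x ∈ convexHull ℝ (part u) → x ∈ convexHull ℝ (part v) →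
      G.Adj u v := by
    intro u v x huv hu hv
    by_contra hnot
    have h₁ : x ∈ {x | key x v < key x u} := by
      refine convexHull_min ?_ (hconv v u) hu
      rintro z ⟨-, rfl⟩
      exact hc z v huv.symm fun h => hnot h.symm
    have h₂ : x ∈ {x | key x u < key x v} := by
      refine convexHull_min ?_ (hconv u v) hv
      rintro z ⟨-, rfl⟩
      exact hc z u huv hnot
    rw [Set.mem_ofPred_eq] at h₁ h₂
    exact lt_asymm h₁ h₂
  let P : ColorPartition (S : Set (EuclideanSpace ℝ (Fin d))) m :=
    { part := fun i => part (ε.symm i)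
      nonempty_part := fun i => convexHull_nonempty_iff.mp ⟨_, hface (.inr (ε.symm i)) _ rfl⟩
      disjoint_part := fun i j hij => Set.disjoint_left.mpr fun x hi hj =>
        hij (ε.symm.injective (hi.2.symm.trans hj.2))
      iUnion_part := by
        ext x
        simp only [Set.mem_iUnion, part, Set.mem_ofPred_eq, Finset.mem_coe]
        exact ⟨fun ⟨i, h⟩ => h.1, fun h => ⟨ε (c x), h, by simp⟩⟩ }
  refine ⟨m, P, ε.symm, fun s => ?_⟩
  have hP : s ∈ P.nerve.faces ↔
      s.Nonempty ∧ ∃ x, ∀ i ∈ s, x ∈ convexHull ℝ (part (ε.symm i)) := by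
    change s.Nonempty ∧ (⋂ i ∈ s, convexHull ℝ (part (ε.symm i))).Nonempty ↔ _
    simp [Set.Nonempty]
  rw [hP]
  have hall : (s.Nonempty ∧ ∃ x, ∀ i ∈ s, x ∈ convexHull ℝ (part (ε.symm i))) ↔
      (s.map ε.symm.toEmbedding).Nonempty ∧
        ∃ x, ∀ v ∈ s.map ε.symm.toEmbedding, x ∈ convexHull ℝ (part v) := by
    simp only [Finset.map_nonempty, Finset.forall_mem_map, Equiv.coe_toEmbedding]
  rw [hall]
  generalize s.map ε.symm.toEmbedding = s'
  constructor
  · rintro (⟨v, hv⟩ | ⟨u, v, huv, hs⟩)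
    · refine ⟨Finset.coe_nonempty.mp (hv ▸ Set.singleton_nonempty v), y (.inr v), fun w hw => ?_⟩
      exact hface (.inr v) w (by rw [← Finset.mem_coe, hv] at hw; exact hw)
    · refine ⟨Finset.coe_nonempty.mp (hs ▸ Set.insert_nonempty u {v}),
        y (.inl ⟨s(u, v), huv⟩), fun w hw => ?_⟩
      rw [← Finset.mem_coe, hs] at hw
      exact hface (.inl ⟨s(u, v), huv⟩) w (Sym2.mem_iff.mpr hw)
  · rintro ⟨hne, x, hx⟩
    have hclique : G.IsClique (s' : Set V) := fun u hu v hv huv =>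
      hadj u v x huv (hx u hu) (hx v hv)
    have hcard : s'.card < 3 := by
      by_contra! h
      obtain ⟨t, hts, ht⟩ := Finset.exists_subset_card_eq h
      exact hG t ⟨hclique.subset (Finset.coe_subset.mpr hts), ht⟩
    have := hne.card_pos
    obtain h | h : s'.card = 1 ∨ s'.card = 2 := by omega
    · obtain ⟨v, rfl⟩ := Finset.card_eq_one.mp h
      exact Or.inl ⟨v, by simp⟩
    · obtain ⟨u, v, huv, rfl⟩ := Finset.card_eq_two.mp h
      exact Or.inr ⟨u, v, hclique (by simp) (by simp) huv, by simp⟩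

/-- Every nonempty finite triangle-free graph is `d`-Tverberg, where `d` is its number of faces. -/
theorem isTverberg_of_cliqueFree_three {V : Type*} [Finite V] [Nonempty V] (G : SimpleGraph V)
    (hG : G.CliqueFree 3) : IsTverberg (Nat.card (G.edgeSet ⊕ V)) (graphComplex G) := by
  obtain ⟨N, hN⟩ := exists_blocks_prescribed_sign (Nat.card (G.edgeSet ⊕ V))
  refine ⟨N, fun S hS hcard => ?_⟩
  obtain ⟨B, hB, hBS, hW⟩ := hN S hS hcard
  let δ := Finite.equivFin (G.edgeSet ⊕ V)
  choose φ hφ using fun v => hW fun j => v ∈ faceVertices G (δ.symm j)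
  refine isPartitionInduced_of_blocks G hG S (B ∘ Prod.map δ id)
    (hB.comp (δ.injective.prodMap Function.injective_id)) (fun _ => hBS _) φ
    (fun v j t h => (hφ v (δ j) t).1 (by simpa using h))
    (fun v j t h => (hφ v (δ j) t).2 (by simpa using h))

end TverbergNerve

theorem mainTheorem1 {V : Type*} [Finite V] [Nonempty V] (G : SimpleGraph V)
    (hG : G.IsBipartite) :
    ∃ d : ℕ, 1 ≤ d ∧ TverbergNerve.IsTverberg d (TverbergNerve.graphComplex G) := by
  refine ⟨_, Nat.card_pos, TverbergNerve.isTverberg_of_cliqueFree_three G ?_⟩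
  exact SimpleGraph.Colorable.cliqueFree hG (by norm_num)
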